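/- Let $n\ge 0$ and $k\ge 1$ be integers and $[n]=\{1,\dots,n\}$. The standard representation of a partition $P$ of $[n]$ is the set of arcs $(i,j)$, $i<j$, such that $i$ and $j$ lie in the same block of $P$ and no element of that block lies strictly between them. For $m\ge 0$, an $m$-crossing of $P$ is a set of $m$ arcs $(i_1,j_1),\dots,(i_m,j_m)$ of the standard representation with $i_1<i_2<\cdots<i_m<j_1<j_2<\cdots<j_m$. Let $\mathrm{cr}(P)$ be the maximal $m$ such that $P$ has an $m$-crossing (so $\mathrm{cr}(P)=0$ if there are no arcs), and call $P$ $k$-noncrossing if $\mathrm{cr}(P)<k$. Let $\epsilon_i$ denote the $i$th unit coordinate vector in $\mathbb{R}^{k-1}$. Then the number of $k$-noncrossing partitions of $[n]$ equals the number of closed lattice walks in the region $$V_k=\{(a_1,a_2,\dots,a_{k-1})\in\mathbb{Z}^{k-1}: a_1\ge a_2\ge\cdots\ge a_{k-1}\ge 0\}$$ from the origin to itself of length $2n$, with steps $\pm\epsilon_i$ ($1\le i\le k-1$) or $(0,\dots,0)$, such that the walk goes backwards (a step $-\epsilon_i$) or stands still (a step $(0,\dots,0)$) after an even number of steps, and goes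 forwards (a step $+\epsilon_i$) or stands still after an odd number of steps. -/

import Mathlib

namespace CrossNest

/-- The standard representation of a partition `P` of `[n] = {1, …, n}`: the set of arcs `(i, j)`,
`i < j`, joining two elements of a block that are consecutive in the numerical order of the
block. -/
def standardRep {n : ℕ} (P : Finpartition (Finset.Icc 1 n)) : Set (ℕ × ℕ) :=
  {e | ∃ B ∈ P.parts, e.1 ∈ B ∧ e.2 ∈ B ∧ e.1 < e.2 ∧ ∀ m ∈ B, ¬ (e.1 < m ∧ m < e.2)}

/-- `P` has an `m`-crossing: arcs `(i₁, j₁), …, (iₘ, jₘ)` of its standard representation with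
`i₁ < ⋯ < iₘ < j₁ < ⋯ < jₘ`. -/
def HasCrossing {n : ℕ} (P : Finpartition (Finset.Icc 1 n)) (m : ℕ) : Prop :=
  ∃ i j : Fin m → ℕ, (∀ r, (i r, j r) ∈ standardRep P) ∧
    StrictMono i ∧ StrictMono j ∧ ∀ r s, i r < j s

/-- `cr(P)`: the maximal `m` such that `P` has an `m`-crossing (`0` if `P` has no arc at all). -/
noncomputable def cr {n : ℕ} (P : Finpartition (Finset.Icc 1 n)) : ℕ :=
  sSup {m | HasCrossing P m}

/-- The supremum in the definition of `cr` is a genuine maximum. -/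
theorem cr_isGreatest {n : ℕ} (P : Finpartition (Finset.Icc 1 n)) :
    IsGreatest {m | HasCrossing P m} (cr P) := by
  have hne : {m | HasCrossing P m}.Nonempty :=
    ⟨0, Fin.elim0, Fin.elim0, fun r => r.elim0, fun r => r.elim0, fun r => r.elim0,
      fun r => r.elim0⟩
  have hb : BddAbove {m | HasCrossing P m} := by
    refine ⟨n, ?_⟩
    rintro m ⟨i, j, h, hi, -, -⟩
    have hsub : Finset.univ.image i ⊆ Finset.Icc 1 n := by
      intro x hx
      obtain ⟨r, -, rfl⟩ := Finset.mem_image.1 hx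
      obtain ⟨B, hB, hr, -⟩ := h r
      exact P.le hB hr
    simpa [Finset.card_image_of_injective _ hi.injective] using Finset.card_le_card hsub
  exact ⟨Nat.sSup_mem hne hb, fun m hm => le_csSup hb hm⟩

/-- `P` is `k`-noncrossing if `cr(P) < k`. -/
def IsNoncrossing {n : ℕ} (k : ℕ) (P : Finpartition (Finset.Icc 1 n)) : Prop :=
  cr P < k

/-- The lattice points `(a₁, …, a_d)` with `a₁ ≥ a₂ ≥ ⋯ ≥ a_d ≥ 0`. -/
def chamber (d : ℕ) : Set (Fin d → ℤ) :=
  {a | Antitone a ∧ ∀ i, 0 ≤ a i}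

/-- `w` lists the `2n + 1` successive positions of a closed lattice walk of length `2n` in the
chamber from the origin to itself; `w t` is the position after `t` steps. After an even number of
steps the walk stands still or makes a step `-εᵢ`, after an odd number of steps it stands still or
makes a step `+εᵢ`. -/
structure IsClosedWalk (d n : ℕ) (w : Fin (2 * n + 1) → Fin d → ℤ) : Prop where
  start : w 0 = 0
  finish : w (Fin.last (2 * n)) = 0
  mem_chamber : ∀ t, w t ∈ chamber d
  step_even : ∀ t : Fin (2 * n), Even (t : ℕ) →
    w t.succ = w t.castSucc ∨ ∃ i, w t.succ = w t.castSucc - Pi.single i 1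
  step_odd : ∀ t : Fin (2 * n), Odd (t : ℕ) →
    w t.succ = w t.castSucc ∨ ∃ i, w t.succ = w t.castSucc + Pi.single i 1

end CrossNest

/-! A partition is encoded by its arcs, that is by the function `p` sending a closer to its opener.
After `t` points, the openers of the arcs still open are the entries of a standard tableau, stored
as a word of length `t`: the letter of label `x` is the row holding `x`, and `0` means that `x` is
absent. Reading the points from `n` down to `1`, passing `t + 1` deletes the label `t + 1`, the
largest possible one, and then row-inserts `p (t + 1)` if an arc closes there. On words, row
insertion turns a `0` into `1`, the next `1` into `2`, the next `2` after that into `3`, and so on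
(`scan`).

Read forwards, the shapes lose at most one box and then gain at most one box per point: this is the
walk. The row that loses a box determines the reverse insertion, and the row that gains one
determines the appended letter, so the walk determines `p`, and every closed walk in the chamber
arises.

The number of rows is controlled as in Schensted's theorem. In a ballot word the largest letter is
the length of a longest strictly increasing subsequence (`Ballot.le_incLen`, `incLen_le_sub`). Under
insertion this length obeys the recursion `incLen_zero_insert`, which is also the recursion
`hasChain_iff_succ` for crossing arcs. Hence `IsGrowth.hasChain_iff`: at most `d` rows always occur
exactly when there is no `(d + 1)`-crossing. -/

/-- The letters `c, c + 1, …` met successively are raised by one. -/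
def scan : ℕ → List ℕ → List ℕ
  | _, [] => []
  | c, a :: l => if a = c then (c + 1) :: scan (c + 1) l else a :: scan c l

/-- The letter that `scan` would raise next at the end of the word. -/
def carry : ℕ → List ℕ → ℕ
  | c, [] => c
  | c, a :: l => if a = c then carry (c + 1) l else carry c l

/-- The letter that the inverse of `scan`, read from right to left, would lower next. -/
def uncarry : List ℕ → ℕ → ℕ
  | [], c => c
  | a :: l, c => if a = uncarry l c then uncarry l c - 1 else uncarry l c

/-- The inverse of `scan`, read from right to left. -/
def unscan : List ℕ → ℕ → List ℕ
  | [], _ => []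
  | a :: l, c => (if a = uncarry l c then a - 1 else a) :: unscan l c

/-- The length of a longest strictly increasing subsequence with letters greater than `b`. -/
def incLen : ℕ → List ℕ → ℕ
  | _, [] => 0
  | b, a :: l => if b < a then max (incLen b l) (1 + incLen a l) else incLen b l

/-! ### Increasing subsequences under row insertion -/

theorem incLen_anti (l : List ℕ) : ∀ {b b' : ℕ}, b ≤ b' → incLen b' l ≤ incLen b l := by
  induction l with
  | nil => intros; simp [incLen]
  | cons a l ih =>
    intro b b' h
    have := ih h
    simp only [incLen]
    split_ifs <;> omega

theorem incLen_le_succ (b : ℕ) (l : List ℕ) : incLen b l ≤ 1 + incLen (b + 1) l := by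
  induction l with
  | nil => simp [incLen]
  | cons a l ih =>
    simp only [incLen]
    rcases lt_trichotomy a (b + 1) with h | rfl | h <;> split_ifs <;> omega

/-- The three ranges of `b` need one joint induction: a raised head moves `c`, and a head used in a
subsequence moves `b`. The last clause bounds any gain above the raised letter by what `l` already
offers above `c`. -/
theorem incLen_scan (l : List ℕ) : ∀ b c : ℕ,
    (b ≤ c → incLen b (scan (c + 1) l) = incLen b l) ∧
    (incLen (c + 1) (scan (c + 1) l) = incLen c l) ∧
    (c + 1 ≤ b → incLen b l ≤ incLen b (scan (c + 1) l) ∧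
      (incLen b (scan (c + 1) l) ≤ incLen b l ∨
        incLen b (scan (c + 1) l) + (b - (c + 1)) ≤ incLen c l)) := by
  induction l with
  | nil => intro b c; simp [scan, incLen]
  | cons a l ih =>
    intro b c
    by_cases h : a = c + 1
    · subst h
      have h1 := ih b (c + 1)
      have h2 := ih c (c + 1)
      have h3 := ih (c + 1) (c + 1)
      have h4 := incLen_anti l (Nat.le_add_right c 1)
      have h6 := incLen_le_succ c l
      have h5 : b ≤ c → incLen c l ≤ incLen b l := fun h => incLen_anti l h
      simp only [scan, incLen, if_true]
      refine ⟨fun hb => ?_, ?_, fun hb => ?_⟩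
      · split_ifs <;> omega
      · split_ifs <;> omega
      · rcases hb.eq_or_lt with rfl | hb'
        · split_ifs <;> omega
        · split_ifs <;> omega
    · have h1 := ih b c
      have h2 := ih a c
      have h4 : b ≤ c → incLen c l ≤ incLen b l := fun h => incLen_anti l h
      have h5 : c ≤ a → incLen a l ≤ incLen c l := fun h => incLen_anti l h
      have h3 := ih (c + 1) c
      simp only [scan, incLen, if_neg h]
      refine ⟨fun hb => ?_, ?_, fun hb => ?_⟩
      · split_ifs <;> omega
      · split_ifs <;> omega
      · split_ifs <;> omega

/-- A letter `a` of `p` becomes the next threshold, hence the arbitrary `b`. The summand `b` makes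
the second alternative survive the prefixing of some `a > b`, which lengthens the subsequence by
one. -/
theorem incLen_insert (p q : List ℕ) : ∀ b : ℕ,
    incLen b (p ++ 0 :: q) ≤ incLen b (p ++ 1 :: scan 1 q) ∧
    (incLen b (p ++ 1 :: scan 1 q) ≤ incLen b (p ++ 0 :: q) ∨
      incLen b (p ++ 1 :: scan 1 q) + b ≤ incLen 0 q + 1) ∧
    (b = 0 → incLen 0 q + 1 ≤ incLen b (p ++ 1 :: scan 1 q)) := by
  induction p with
  | nil =>
    intro b
    have h1 := incLen_scan q b 0
    have h2 := incLen_scan q 0 0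
    simp only [List.nil_append, incLen, zero_add] at *
    rcases Nat.eq_zero_or_pos b with rfl | hb
    · simp; omega
    · split_ifs <;> omega
  | cons a p ih =>
    intro b
    have h1 := ih b
    have h2 := ih a
    simp only [List.cons_append, incLen]
    split_ifs <;> omega

theorem incLen_zero_insert (p q : List ℕ) :
    incLen 0 (p ++ 1 :: scan 1 q) = max (incLen 0 (p ++ 0 :: q)) (incLen 0 q + 1) := by
  have := incLen_insert p q 0
  omega

/-! ### Bookkeeping for insertion and its inverse -/

theorem length_scan (l : List ℕ) : ∀ c, (scan c l).length = l.length := by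
  induction l with
  | nil => simp [scan]
  | cons a l ih => intro c; simp only [scan]; split_ifs <;> simp [ih]

theorem take_scan (l : List ℕ) : ∀ c x, (scan c l).take x = scan c (l.take x) := by
  induction l with
  | nil => simp [scan]
  | cons a l ih =>
    intro c x
    cases x with
    | zero => simp [scan]
    | succ x => simp only [scan, List.take_succ_cons]; split_ifs <;> simp [ih]

theorem drop_scan (l : List ℕ) : ∀ c x, ∃ c', (scan (c + 1) l).drop x = scan (c' + 1) (l.drop x) := by
  induction l with
  | nil => intro c x; exact ⟨0, by simp [scan]⟩
  | cons a l ih =>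
    intro c x
    cases x with
    | zero => exact ⟨c, by simp⟩
    | succ x =>
      simp only [scan, List.drop_succ_cons]
      split_ifs
      · simpa using ih (c + 1) x
      · simpa using ih c x

theorem count_scan (l : List ℕ) : ∀ c r, (scan c l).count r + (if r = c then 1 else 0) =
    l.count r + (if r = carry c l then 1 else 0) := by
  induction l with
  | nil => intro c r; rfl
  | cons a l ih =>
    intro c r
    simp only [scan, carry]
    by_cases h : a = c
    · have := ih (c + 1) r
      simp only [h, if_true, List.count_cons, beq_iff_eq]
      split_ifs at this ⊢ <;> omega
    · have := ih c r
      simp only [h, if_false, List.count_cons, beq_iff_eq]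
      split_ifs at this ⊢ <;> omega

theorem le_carry (l : List ℕ) : ∀ c, c ≤ carry c l := by
  induction l with
  | nil => simp [carry]
  | cons a l ih =>
    intro c
    simp only [carry]
    split_ifs
    · exact (Nat.le_succ c).trans (ih _)
    · exact ih c

theorem getElem?_scan_eq_zero (l : List ℕ) : ∀ c x : ℕ,
    (scan (c + 1) l)[x]? = some 0 ↔ l[x]? = some 0 := by
  induction l with
  | nil => simp [scan]
  | cons a l ih =>
    intro c x
    cases x with
    | zero => simp only [scan]; split_ifs <;> simp; omega
    | succ x => simp only [scan]; split_ifs <;> simp [ih]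

theorem uncarry_scan (l : List ℕ) : ∀ c, uncarry (scan c l) (carry c l) = c := by
  induction l with
  | nil => simp [scan, carry, uncarry]
  | cons a l ih =>
    intro c
    simp only [scan, carry]
    split_ifs with h <;> simp [uncarry, ih, h]

theorem unscan_scan (l : List ℕ) : ∀ c, unscan (scan c l) (carry c l) = l := by
  induction l with
  | nil => simp [scan, unscan]
  | cons a l ih =>
    intro c
    simp only [scan, carry]
    split_ifs with h <;> simp [unscan, uncarry_scan, ih, h]

/-- Undoing the inserted `1` brings the pending letter to `0`, where truncated subtraction keeps it,
so `p` is left unchanged. -/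
theorem uncarry_insert (p q : List ℕ) : uncarry (p ++ 1 :: scan 1 q) (carry 1 q) = 0 := by
  induction p with
  | nil => simp [uncarry, uncarry_scan]
  | cons a p ih => simp [uncarry, ih]

theorem unscan_insert (p q : List ℕ) :
    unscan (p ++ 1 :: scan 1 q) (carry 1 q) = p ++ 0 :: q := by
  induction p with
  | nil => simp [unscan, uncarry_scan, unscan_scan]
  | cons a p ih =>
    simp only [List.cons_append, unscan, uncarry_insert, ih]
    split_ifs <;> simp [*]

/-- Either the pending letter is still positive at the left end, or some `1` was lowered to `0`;
that place is where a label had been inserted. -/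
theorem scan_unscan (l : List ℕ) (c : ℕ) (hc : 0 < c) :
    (0 < uncarry l c → scan (uncarry l c) (unscan l c) = l ∧ carry (uncarry l c) (unscan l c) = c) ∧
    (uncarry l c = 0 → ∃ p q, unscan l c = p ++ 0 :: q ∧ l = p ++ 1 :: scan 1 q ∧
      carry 1 q = c) := by
  induction l with
  | nil => exact ⟨fun _ => by simp [scan, unscan, uncarry, carry], fun h => by simp [uncarry] at h; omega⟩
  | cons a l ih =>
    obtain ⟨ih1, ih2⟩ := ih
    simp only [uncarry, unscan]
    rcases Nat.eq_zero_or_pos (uncarry l c) with h0 | h0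
    · obtain ⟨p, q, h1, h2, h3⟩ := ih2 h0
      have : (if a = uncarry l c then a - 1 else a) = a := by split_ifs <;> omega
      rw [this, h0]
      refine ⟨fun h => by simp at h, fun _ => ⟨a :: p, q, by simp [h1], by simp [← h2], h3⟩⟩
    · obtain ⟨h1, h2⟩ := ih1 h0
      split_ifs with ha
      · refine ⟨fun h => ?_, fun h => ⟨[], unscan l c, ?_⟩⟩
        · have e : uncarry l c - 1 + 1 = uncarry l c := by omega
          rw [ha]; simp [scan, carry, e, h1, h2]
        · have e : uncarry l c = 1 := by omega
          rw [e] at ha h1 h2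
          simp [ha, h1, h2]
      · refine ⟨fun h => ?_, fun h => by omega⟩
        simp [scan, carry, ha, h1, h2]

/-! ### Ballot words, that is standard tableaux -/

/-- The row lengths `f` after adding a box to the `a`-th row, rows being counted from `1`;
nothing is added if `a = 0`. -/
def addBox (a : ℕ) (f : ℕ → ℕ) : ℕ → ℕ := fun r => f r + if r + 1 = a then 1 else 0

/-- Starting from the row lengths `f` and adding boxes to the rows given by the letters of the
word, one goes through partition shapes only. -/
def Ballot : (ℕ → ℕ) → List ℕ → Prop
  | f, [] => ∀ r, f (r + 1) ≤ f r
  | f, a :: l => (∀ r, f (r + 1) ≤ f r) ∧ Ballot (addBox a f) l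

theorem addBox_zero (f : ℕ → ℕ) : addBox 0 f = f := by
  funext r; simp [addBox]

theorem addBox_comm (a b : ℕ) (f : ℕ → ℕ) : addBox a (addBox b f) = addBox b (addBox a f) := by
  funext r; simp only [addBox]; omega

theorem Ballot.start {f : ℕ → ℕ} {l : List ℕ} (h : Ballot f l) : ∀ r, f (r + 1) ≤ f r := by
  cases l with
  | nil => exact h
  | cons a l => exact h.1

theorem ballot_append {p q : List ℕ} : ∀ {f : ℕ → ℕ},
    Ballot f (p ++ q) ↔ Ballot f p ∧ Ballot (fun r => f r + p.count (r + 1)) q := by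
  induction p with
  | nil => intro f; simpa [Ballot] using fun h => h.start
  | cons a p ih =>
    intro f
    have : (fun r => addBox a f r + p.count (r + 1)) =
        fun r => f r + (a :: p).count (r + 1) := by
      funext r
      simp only [addBox, List.count_cons, beq_iff_eq, eq_comm (a := a)]
      omega
    simp only [List.cons_append, Ballot, ih, this, and_assoc]

theorem Ballot.finish {f : ℕ → ℕ} {l : List ℕ} (h : Ballot f l) :
    ∀ r, f (r + 1) + l.count (r + 1 + 1) ≤ f r + l.count (r + 1) := by
  have : Ballot f (l ++ []) := by simpa using h
  exact (ballot_append.1 this).2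

/-- At each moment the new shape is the old one with one more box, in the row that the scan would
raise next. -/
theorem Ballot.scan {l : List ℕ} : ∀ {f : ℕ → ℕ} {c : ℕ}, Ballot f l →
    (∀ r, addBox (c + 1) f (r + 1) ≤ addBox (c + 1) f r) →
    Ballot (addBox (c + 1) f) (scan (c + 1) l) := by
  induction l with
  | nil => intro f c _ h; exact h
  | cons a l ih =>
    intro f c h hc
    have h1 := h.1
    have h2 := h.2.start
    simp only [_root_.scan]
    split_ifs with ha
    · subst ha
      refine ⟨hc, ih h.2 fun r => ?_⟩
      have := h1 r
      have := hc r
      simp only [addBox] at *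
      split_ifs at * <;> omega
    · refine ⟨hc, ?_⟩
      rw [addBox_comm]
      refine ih h.2 fun r => ?_
      have := h2 r
      have := hc r
      simp only [addBox] at *
      split_ifs at * <;> omega

theorem Ballot.insert {p q : List ℕ} {f : ℕ → ℕ} (h : Ballot f (p ++ 0 :: q)) :
    Ballot f (p ++ 1 :: _root_.scan 1 q) := by
  rw [ballot_append] at h ⊢
  refine ⟨h.1, h.2.1, ?_⟩
  have h2 := h.2.2
  rw [addBox_zero] at h2
  refine Ballot.scan h2 fun r => ?_
  have := h.2.1 r
  simp only [addBox] at this ⊢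
  split_ifs <;> omega

/-- The same picture from right to left. The strict inequality says that the final shape has a
corner in the row of index `c`; this corner travels to row `uncarry`, or disappears once a label is
ejected. -/
theorem Ballot.unscan {l : List ℕ} (c : ℕ) : ∀ {g : ℕ → ℕ}, Ballot g l →
    g (c + 1) + l.count (c + 1 + 1) < g c + l.count (c + 1) →
    (uncarry l (c + 1) = 0 → Ballot g (unscan l (c + 1))) ∧
    (∀ d, uncarry l (c + 1) = d + 1 →
      ∃ f, g = addBox (d + 1) f ∧ Ballot f (unscan l (c + 1))) := by
  have key : ∀ (g : ℕ → ℕ) (d : ℕ), (∀ r, g (r + 1) ≤ g r) → g (d + 1) < g d →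
      ∃ f, g = addBox (d + 1) f ∧ ∀ r, f (r + 1) ≤ f r := by
    intro g d hg hd
    refine ⟨fun r => g r - if r = d then 1 else 0, ?_, fun r => ?_⟩
    · funext r
      simp only [addBox, add_left_inj]
      split_ifs with h
      · subst h; omega
      · rfl
    · have := hg r
      dsimp only
      split_ifs with h1 h2 h2
      · omega
      · omega
      · subst h2; omega
      · omega
  induction l with
  | nil =>
    intro g h hc
    refine ⟨fun h0 => by simp [uncarry] at h0, fun d hd => ?_⟩
    simp only [uncarry, Nat.add_right_cancel_iff] at hd
    subst hd
    simpa [_root_.unscan, Ballot] using key g c h (by simpa using hc)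
  | cons a l ih =>
    intro g h hc
    have hg := h.1
    have hg' := h.2.start
    have hc' : addBox a g (c + 1) + l.count (c + 1 + 1) < addBox a g c + l.count (c + 1) := by
      simp only [List.count_cons, beq_iff_eq, eq_comm (a := a)] at hc
      simp only [addBox]
      omega
    obtain ⟨ih0, ih1⟩ := ih h.2 hc'
    rcases hu : uncarry l (c + 1) with _ | d
    · have e : (if a = 0 then a - 1 else a) = a := by split_ifs <;> omega
      simp only [uncarry, _root_.unscan, hu, e]
      refine ⟨fun _ => ⟨hg, ih0 hu⟩, fun d hd => ?_⟩
      split_ifs at hd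
    · obtain ⟨f', hf', hb⟩ := ih1 d hu
      have hp := hb.start
      have hfr : ∀ r, g r + (if r + 1 = a then 1 else 0) = f' r + if r = d then 1 else 0 := by
        intro r
        simpa [addBox] using congrFun hf' r
      simp only [uncarry, _root_.unscan, hu]
      by_cases ha : a = d + 1
      · subst ha
        have e : f' = g := by
          funext r
          simpa using (hfr r).symm
        subst e
        simp only [if_true, Nat.add_sub_cancel]
        refine ⟨fun h0 => ⟨hg, by rwa [h0, addBox_zero]⟩, fun d' hd' => ?_⟩
        subst hd'
        obtain ⟨f, hf, hpf⟩ := key f' d' hg (by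
          have := hg' d'
          simpa [addBox] using this)
        exact ⟨f, hf, hpf, hf ▸ hb⟩
      · simp only [ha, if_false]
        refine ⟨fun h0 => by omega, fun d' hd' => ?_⟩
        obtain rfl : d = d' := by omega
        obtain ⟨f, hf, hpf⟩ := key g d hg (by
          have h1 := hfr d
          have h2 := hfr (d + 1)
          have := hp d
          split_ifs at h1 h2 <;> omega)
        refine ⟨f, hf, hpf, ?_⟩
        have : addBox a f = f' := by
          funext r
          have := hfr r
          rw [hf] at this
          simp only [addBox, Nat.add_right_cancel_iff] at this ⊢
          omega
        rwa [this]

theorem incLen_le_sub {l : List ℕ} {M : ℕ} (h : ∀ x ∈ l, x ≤ M) : ∀ b, incLen b l ≤ M - b := by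
  induction l with
  | nil => simp [incLen]
  | cons a l ih =>
    intro b
    have h1 := h a (by simp)
    have ih' := ih fun x hx => h x (by simp [hx])
    have := ih' a
    have := ih' b
    simp only [incLen]
    split_ifs <;> omega

/-- With at most `b` rows present, the first letter above `b` must be `b + 1`; inductively `b + 1,
…, v` occur in this order. -/
theorem Ballot.le_incLen {l : List ℕ} {v : ℕ} (hv : v ∈ l) : ∀ {f : ℕ → ℕ} {b : ℕ}, Ballot f l →
    (∀ r, b ≤ r → f r = 0) → v ≤ b + incLen b l := by
  induction l with
  | nil => simp at hv
  | cons a l ih =>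
    intro f b h hf
    have ha : a ≤ b + 1 := by
      by_contra hab
      obtain ⟨r, rfl⟩ : ∃ r, a = r + 2 := ⟨a - 2, by omega⟩
      have := h.2.start r
      simp only [addBox] at this
      rw [hf r (by omega), hf (r + 1) (by omega)] at this
      simp at this
    rcases List.mem_cons.1 hv with rfl | hv'
    · simp only [incLen]
      split_ifs <;> omega
    · rcases ha.lt_or_eq with hab | rfl
      · have := ih hv' h.2 (b := b) fun r hr => by
          simp only [addBox, hf r hr]
          split_ifs <;> omega
        simp only [incLen]
        split_ifs <;> omega
      · have := ih hv' h.2 (b := b + 1) fun r hr => by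
          simp only [addBox, hf r (by omega)]
          split_ifs <;> omega
        simp only [incLen]
        split_ifs <;> omega

/-! ### Insertion of a single label -/

/-- `T` arises from `U` by inserting the label `j`, whose letter has the index `j - 1`. -/
def IsInsertion (j : ℕ) (T U : List ℕ) : Prop :=
  ∃ p q, U = p ++ 0 :: q ∧ T = p ++ 1 :: scan 1 q ∧ j = p.length + 1

/-- `T` arises from `U` by inserting the label `j`, or equals `U` if `j = 0`. -/
def IsClosing (j : ℕ) (T U : List ℕ) : Prop :=
  (j = 0 ∧ T = U) ∨ IsInsertion j T U

theorem IsInsertion.pos {j : ℕ} {T U : List ℕ} (h : IsInsertion j T U) : 0 < j := by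
  obtain ⟨p, q, -, -, rfl⟩ := h
  omega

theorem IsClosing.length_eq {j : ℕ} {T U : List ℕ} (h : IsClosing j T U) :
    T.length = U.length := by
  obtain ⟨-, rfl⟩ | ⟨p, q, rfl, rfl, -⟩ := h
  · rfl
  · simp [length_scan]

theorem IsClosing.le_length {j : ℕ} {T U : List ℕ} (h : IsClosing j T U) : j ≤ T.length := by
  obtain ⟨rfl, -⟩ | ⟨p, q, rfl, rfl, rfl⟩ := h
  · exact Nat.zero_le _
  · simp

theorem IsClosing.ballot {j : ℕ} {T U : List ℕ} (h : IsClosing j T U) {f : ℕ → ℕ}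
    (hU : Ballot f U) : Ballot f T := by
  obtain ⟨-, rfl⟩ | ⟨p, q, rfl, rfl, -⟩ := h
  · exact hU
  · exact hU.insert

theorem IsClosing.getElem?_eq_zero {j : ℕ} {T U : List ℕ} (h : IsClosing j T U) (x : ℕ) :
    T[x]? = some 0 ↔ U[x]? = some 0 ∧ j ≠ x + 1 := by
  obtain ⟨rfl, rfl⟩ | ⟨p, q, rfl, rfl, rfl⟩ := h
  · simp
  · rcases lt_trichotomy x p.length with hx | rfl | hx
    · simp only [List.getElem?_append_left hx]
      constructor
      · intro h; exact ⟨h, by omega⟩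
      · exact fun h => h.1
    · simp
    · obtain ⟨y, rfl⟩ : ∃ y, x = p.length + 1 + y := ⟨x - p.length - 1, by omega⟩
      have e : p.length + 1 + y - p.length = y + 1 := by omega
      rw [List.getElem?_append_right (by omega), List.getElem?_append_right (by omega), e]
      simp only [List.getElem?_cons_succ]
      rw [getElem?_scan_eq_zero q 0 y]
      constructor
      · intro h; exact ⟨h, by omega⟩
      · exact fun h => h.1

theorem count_insert (p q : List ℕ) {c : ℕ} (hc : carry 1 q = c + 1) (r : ℕ) :
    (p ++ 1 :: scan 1 q).count (r + 1) =
      (p ++ 0 :: q).count (r + 1) + if r = c then 1 else 0 := by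
  have := count_scan q 1 (r + 1)
  simp only [hc, Nat.add_right_cancel_iff] at this
  simp only [List.count_append, List.count_cons, beq_iff_eq, eq_comm (a := 1),
    if_neg (Nat.succ_ne_zero r).symm]
  omega

theorem IsInsertion.exists_row {j : ℕ} {T U : List ℕ} (h : IsInsertion j T U) :
    ∃ c, (∀ r, T.count (r + 1) = U.count (r + 1) + if r = c then 1 else 0) ∧
      unscan T (c + 1) = U := by
  obtain ⟨p, q, rfl, rfl, -⟩ := h
  obtain ⟨c, hc⟩ : ∃ c, carry 1 q = c + 1 :=
    ⟨carry 1 q - 1, by have := le_carry q 1; omega⟩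
  refine ⟨c, count_insert p q hc, hc ▸ unscan_insert p q⟩

theorem IsClosing.count_le {j : ℕ} {T U : List ℕ} (h : IsClosing j T U) (r : ℕ) :
    U.count (r + 1) ≤ T.count (r + 1) := by
  obtain ⟨-, rfl⟩ | h := h
  · exact le_rfl
  · obtain ⟨c, hc, -⟩ := h.exists_row
    rw [hc]
    omega

theorem IsClosing.forall_mem_le {j d : ℕ} {T U : List ℕ} (h : IsClosing j T U)
    (hT : ∀ x ∈ T, x ≤ d) : ∀ x ∈ U, x ≤ d := by
  intro x hx
  rcases x with _ | x
  · exact Nat.zero_le d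
  · exact hT _ (List.count_pos_iff.1 ((List.count_pos_iff.2 hx).trans_le (h.count_le x)))

theorem lt_of_count_eq_add {d c : ℕ} {T U : List ℕ} (hT : ∀ x ∈ T, x ≤ d)
    (hc : ∀ r, T.count (r + 1) = U.count (r + 1) + if r = c then 1 else 0) : c < d := by
  have : 0 < T.count (c + 1) := by rw [hc]; simp
  exact hT _ (List.count_pos_iff.1 this)

/-- The counts reveal the row of the lost box, and `unscan` then gives `U`. The label is read off
from the only index at which the zeros of `T` and `U` differ. -/
theorem IsClosing.unique {j j' d : ℕ} {T U U' : List ℕ} (h : IsClosing j T U)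
    (h' : IsClosing j' T U') (hT : ∀ x ∈ T, x ≤ d)
    (hU : ∀ r < d, U.count (r + 1) = U'.count (r + 1)) : j = j' ∧ U = U' := by
  have absurd_of : ∀ {j : ℕ} {U : List ℕ}, IsInsertion j T U →
      (∀ r < d, U.count (r + 1) = T.count (r + 1)) → False := by
    intro j U hi hU
    obtain ⟨c, hc, -⟩ := hi.exists_row
    have h1 := hU c (lt_of_count_eq_add hT hc)
    rw [hc] at h1
    simp at h1
  rcases h with ⟨rfl, rfl⟩ | h
  · rcases h' with ⟨rfl, rfl⟩ | h'
    · exact ⟨rfl, rfl⟩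
    · exact (absurd_of h' fun r hr => (hU r hr).symm).elim
  · rcases h' with ⟨rfl, rfl⟩ | h'
    · exact (absurd_of h hU).elim
    · obtain ⟨c, hc, hu⟩ := h.exists_row
      obtain ⟨c', hc', hu'⟩ := h'.exists_row
      have hcd := lt_of_count_eq_add hT hc
      obtain rfl : c = c' := by
        have h1 := hc c
        have h2 := hc' c
        have h3 := hU c hcd
        simp only [if_true] at h1
        by_contra hne
        rw [if_neg hne] at h2
        omega
      obtain rfl : U = U' := hu.symm.trans hu'
      refine ⟨?_, rfl⟩
      have h1 := IsClosing.getElem?_eq_zero (.inr h)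
      have h2 := IsClosing.getElem?_eq_zero (.inr h')
      obtain ⟨p, q, rfl, -, rfl⟩ := h
      by_contra hne
      have := (h1 p.length).symm.trans (h2 p.length)
      simp at this
      omega

theorem Ballot.exists_isInsertion {T : List ℕ} {c : ℕ} (h : Ballot 0 T)
    (hc : T.count (c + 1 + 1) < T.count (c + 1)) :
    ∃ j U, IsInsertion j T U ∧ Ballot 0 U ∧
      ∀ r, T.count (r + 1) = U.count (r + 1) + if r = c then 1 else 0 := by
  obtain ⟨h0, h1⟩ := h.unscan c (by simpa using hc)
  -- The empty starting shape has no box to give up, so a label must have been ejected.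
  have hu : uncarry T (c + 1) = 0 := by
    rcases hu : uncarry T (c + 1) with _ | d
    · rfl
    · obtain ⟨f, hf, -⟩ := h1 d hu
      have := congrFun hf d
      simp [addBox] at this
  obtain ⟨p, q, hp, hq, hcar⟩ := (scan_unscan T (c + 1) (by omega)).2 hu
  refine ⟨_, _, ⟨p, q, rfl, hq, rfl⟩, hp ▸ h0 hu, fun r => ?_⟩
  conv_lhs => rw [hq]
  exact count_insert p q hcar r

/-! ### From arcs to sequences of tableaux -/

/-- `p t` is the opener of the arc with the closer `t`, or `0` if there is no such arc, in a set of
arcs on `1, …, n` with distinct openers and distinct closers. -/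
structure IsOpener (n : ℕ) (p : ℕ → ℕ) : Prop where
  lt : ∀ t, p t ≠ 0 → p t < t
  le : ∀ t, p t ≠ 0 → t ≤ n
  inj : ∀ s t, p s = p t → p s ≠ 0 → s = t

/-- `T t` is the tableau of the arcs open after the first `t` points, as the word of the rows of
the labels `1, …, t`. -/
structure IsGrowth (n : ℕ) (p : ℕ → ℕ) (T : ℕ → List ℕ) : Prop where
  length : ∀ t ≤ n, (T t).length = t
  last : T n = List.replicate n 0
  closing : ∀ t < n, IsClosing (p (t + 1)) (T t) (T (t + 1)).dropLast

theorem IsOpener.exists_isGrowth {n : ℕ} {p : ℕ → ℕ} (hp : IsOpener n p) :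
    ∃ T, IsGrowth n p T := by
  -- The zeros mark exactly the labels of the first `t` points that open no arc closing after `t`.
  let Inv : ℕ → List ℕ → Prop := fun t L =>
    L.length = t ∧ ∀ x, L[x]? = some 0 ↔ x < t ∧ ∀ s, t < s → p s ≠ x + 1
  have step : ∀ t L, ∃ L', t < n → Inv (t + 1) L →
      IsClosing (p (t + 1)) L' L.dropLast ∧ Inv t L' := by
    intro t L
    by_cases h : t < n ∧ Inv (t + 1) L
    swap
    · exact ⟨[], fun h1 h2 => (h ⟨h1, h2⟩).elim⟩
    obtain ⟨ht, hl, hL⟩ := h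
    have hU : ∀ x, L.dropLast[x]? = some 0 ↔ x < t ∧ ∀ s, t + 1 < s → p s ≠ x + 1 := by
      intro x
      rw [List.getElem?_dropLast, hl]
      split_ifs with hx
      · rw [hL]
        exact ⟨fun h => ⟨by omega, h.2⟩, fun h => ⟨by omega, h.2⟩⟩
      · simp only [false_iff]
        omega
    have hUl : L.dropLast.length = t := by simp [hl]
    obtain ⟨L', hL'⟩ : ∃ L', IsClosing (p (t + 1)) L' L.dropLast := by
      rcases hj : p (t + 1) with _ | j
      · exact ⟨_, .inl ⟨rfl, rfl⟩⟩
      · have hjt : j < t := by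
          have := hp.lt (t + 1) (by omega)
          omega
        -- By injectivity of `p` no later closer uses this label, so its place is free.
        have h0 : L.dropLast[j]? = some 0 := by
          rw [hU]
          refine ⟨hjt, fun s hs he => ?_⟩
          have := hp.inj s (t + 1) (by omega) (by omega)
          omega
        obtain ⟨hlt, h0'⟩ := List.getElem?_eq_some_iff.1 h0
        refine ⟨_, .inr ⟨L.dropLast.take j, L.dropLast.drop (j + 1), ?_, rfl, ?_⟩⟩
        · rw [← h0', List.getElem_cons_drop, List.take_append_drop]
        · rw [List.length_take]; omega
    refine ⟨L', fun _ _ => ⟨hL', hL'.length_eq.trans hUl, fun x => ?_⟩⟩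
    rw [hL'.getElem?_eq_zero, hU]
    constructor
    · rintro ⟨⟨h1, h2⟩, h3⟩
      refine ⟨h1, fun s hs => ?_⟩
      rcases Nat.eq_or_lt_of_le (Nat.succ_le_of_lt hs) with rfl | hs'
      · exact h3
      · exact h2 s hs'
    · rintro ⟨h1, h2⟩
      exact ⟨⟨h1, fun s hs => h2 s (by omega)⟩, h2 _ (Nat.lt_succ_self t)⟩
  choose F hF using step
  -- `R s` is the tableau after `n - s` points.
  let R : ℕ → List ℕ := fun s => Nat.rec (List.replicate n 0) (fun s L => F (n - s - 1) L) s
  have hInv : ∀ s ≤ n, Inv (n - s) (R s) := by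
    intro s
    induction s with
    | zero =>
      intro _
      refine ⟨by simp [R], fun x => ?_⟩
      simp only [R, Nat.sub_zero]
      constructor
      · intro h
        refine ⟨by by_contra hx; simp [hx] at h, fun s hs he => ?_⟩
        have := hp.le s (by omega)
        omega
      · intro h
        simp [h.1]
    | succ s ih =>
      intro hs
      have e : n - s = n - s - 1 + 1 := by omega
      have := (hF (n - s - 1) (R s) (by omega) (e ▸ ih (by omega))).2
      exact this
  refine ⟨fun t => R (n - t), fun t ht => ?_, by simp [R], fun t ht => ?_⟩
  · have := (hInv (n - t) (by omega)).1
    omega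
  · have e1 : n - (n - (t + 1)) - 1 = t := by omega
    have e2 : n - (n - (t + 1)) = t + 1 := by omega
    have e3 : n - t = (n - (t + 1)) + 1 := by omega
    have hI := hInv (n - (t + 1)) (by omega)
    rw [e2] at hI
    have h1 := (hF t (R (n - (t + 1))) ht hI).1
    have h2 : R (n - t) = F t (R (n - (t + 1))) := by
      rw [e3]
      simp only [R]
      rw [e1]
    simpa only [h2] using h1

theorem IsClosing.unique_left {j : ℕ} {T T' U : List ℕ} (h : IsClosing j T U)
    (h' : IsClosing j T' U) : T = T' := by
  rcases h with ⟨rfl, rfl⟩ | h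
  · rcases h' with ⟨-, rfl⟩ | h'
    · rfl
    · exact (lt_irrefl _ h'.pos).elim
  · rcases h' with ⟨rfl, -⟩ | ⟨p', q', hU', rfl, hj'⟩
    · exact (lt_irrefl _ h.pos).elim
    · obtain ⟨p, q, rfl, rfl, rfl⟩ := h
      obtain ⟨rfl, h2⟩ := List.append_inj hU' (by omega)
      simp only [List.cons.injEq, true_and] at h2
      rw [h2]

theorem IsGrowth.unique {n : ℕ} {p : ℕ → ℕ} {T T' : ℕ → List ℕ} (h : IsGrowth n p T)
    (h' : IsGrowth n p T') : ∀ t ≤ n, T t = T' t := by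
  intro t ht
  induction ht using Nat.decreasingInduction with
  | self => rw [h.last, h'.last]
  | of_succ t ht ih =>
    have h1 := h.closing t ht
    rw [ih] at h1
    exact h1.unique_left (h'.closing t ht)

theorem ballot_replicate_zero (n : ℕ) : Ballot 0 (List.replicate n 0) := by
  induction n with
  | zero => exact fun _ => le_rfl
  | succ n ih => exact ⟨fun _ => le_rfl, by rwa [addBox_zero]⟩

theorem Ballot.dropLast {f : ℕ → ℕ} {l : List ℕ} (h : Ballot f l) : Ballot f l.dropLast := by
  rcases List.eq_nil_or_concat l with rfl | ⟨l', a, rfl⟩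
  · exact h
  · rw [List.concat_eq_append] at h ⊢
    rw [List.dropLast_concat]
    exact (ballot_append.1 h).1

theorem IsGrowth.ballot {n : ℕ} {p : ℕ → ℕ} {T : ℕ → List ℕ} (h : IsGrowth n p T) :
    ∀ t ≤ n, Ballot 0 (T t) := by
  intro t ht
  induction ht using Nat.decreasingInduction with
  | self => rw [h.last]; exact ballot_replicate_zero n
  | of_succ t ht ih => exact (h.closing t ht).ballot ih.dropLast

/-! ### Crossing arcs as increasing subsequences -/

/-- There are `m` mutually crossing arcs with openers in `(a, c]` and closers greater than `t`;
the list is that of the closers. -/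
def HasChain (p : ℕ → ℕ) (t a c m : ℕ) : Prop :=
  ∃ l : List ℕ, l.length = m ∧ l.Pairwise (fun x y => x < y ∧ p x < p y) ∧
    ∀ x ∈ l, t < x ∧ a < p x ∧ p x ≤ c

/-- Closers increase along a chain, so the arc closing at `t + 1` can only be its first member, and
the remaining openers then exceed `p (t + 1)`. -/
theorem hasChain_iff_succ {p : ℕ → ℕ} {t a c m : ℕ} : HasChain p t a c m ↔
    HasChain p (t + 1) a c m ∨ (a < p (t + 1) ∧ p (t + 1) ≤ c ∧
      ∃ m', m = m' + 1 ∧ HasChain p (t + 1) (p (t + 1)) c m') := by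
  constructor
  · rintro ⟨l, rfl, hl, hb⟩
    rcases l with _ | ⟨x, l⟩
    · exact .inl ⟨[], rfl, .nil, by simp⟩
    · rw [List.pairwise_cons] at hl
      have hx := hb x (by simp)
      rcases Nat.eq_or_lt_of_le (Nat.succ_le_of_lt hx.1) with rfl | hs
      · exact .inr ⟨hx.2.1, hx.2.2, l.length, rfl, l, rfl, hl.2, fun y hy =>
          ⟨(hl.1 y hy).1, (hl.1 y hy).2, (hb y (by simp [hy])).2.2⟩⟩
      · refine .inl ⟨x :: l, rfl, List.pairwise_cons.2 hl, fun y hy => ⟨?_, (hb y hy).2⟩⟩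
        rcases List.mem_cons.1 hy with rfl | hy'
        · exact hs
        · exact lt_trans hs (hl.1 y hy').1
  · rintro (⟨l, rfl, hl, hb⟩ | ⟨h1, h2, m', rfl, l, rfl, hl, hb⟩)
    · exact ⟨l, rfl, hl, fun x hx => ⟨(Nat.lt_succ_self t).trans (hb x hx).1, (hb x hx).2⟩⟩
    · refine ⟨(t + 1) :: l, rfl, List.pairwise_cons.2 ⟨fun y hy => ⟨(hb y hy).1, (hb y hy).2.1⟩, hl⟩,
        fun y hy => ?_⟩
      rcases List.mem_cons.1 hy with rfl | hy'
      · exact ⟨Nat.lt_succ_self t, h1, h2⟩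
      · have := hb y hy'
        exact ⟨by omega, by omega, this.2.2⟩

theorem incLen_replicate_zero (b n : ℕ) : incLen b (List.replicate n 0) = 0 := by
  induction n with
  | zero => rfl
  | succ n ih => simp [List.replicate_succ, incLen, ih]

/-- The recursion asks for chains with openers beyond `p (t + 1)`, so the induction must treat all
windows `(a, c]`. A window right of the inserted label is only scanned, which preserves `incLen 0`;
one left of it is untouched; one containing it follows `incLen_zero_insert`. -/
theorem IsGrowth.hasChain_iff {n : ℕ} {p : ℕ → ℕ} {T : ℕ → List ℕ} (hp : IsOpener n p)
    (h : IsGrowth n p T) : ∀ t ≤ n, ∀ a c m, c ≤ t →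
      (HasChain p t a c m ↔ m ≤ incLen 0 (((T t).take c).drop a)) := by
  intro t ht
  induction ht using Nat.decreasingInduction with
  | self =>
    intro a c m _
    rw [h.last, List.take_replicate, List.drop_replicate, incLen_replicate_zero, Nat.le_zero]
    constructor
    · rintro ⟨l, rfl, -, hb⟩
      rcases l with _ | ⟨x, l⟩
      · rfl
      · have h1 := hb x (by simp)
        have := hp.le x (by omega)
        omega
    · rintro rfl
      exact ⟨[], rfl, .nil, by simp⟩
  | of_succ t ht ih =>
    intro a c m hc
    have hlen := h.length (t + 1) ht
    have htake : ∀ c ≤ t, (T (t + 1)).take c = (T (t + 1)).dropLast.take c := by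
      intro c hc
      rw [List.dropLast_eq_take, List.take_take, min_eq_left (by omega)]
    have ih' := fun a m => ih a c m (by omega)
    simp only [htake c hc] at ih'
    rw [hasChain_iff_succ]
    simp only [ih']
    rcases h.closing t ht with ⟨h0, hT⟩ | ⟨u, v, hU, hT, hj⟩
    · rw [h0, hT]
      simp
    · rw [hj, hU, hT]
      rcases Nat.lt_or_ge u.length c with hcj | hcj
      · obtain ⟨x, rfl⟩ : ∃ x, c = u.length + (x + 1) := ⟨c - u.length - 1, by omega⟩
        simp only [List.take_length_add_append, List.take_succ_cons, take_scan]
        have e1 : ((u ++ 0 :: v.take x).drop (u.length + 1)) = v.take x := by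
          rw [List.drop_length_add_append]; simp
        rw [e1]
        rcases Nat.lt_or_ge u.length a with haj | haj
        · obtain ⟨y, rfl⟩ : ∃ y, a = u.length + (y + 1) := ⟨a - u.length - 1, by omega⟩
          simp only [List.drop_length_add_append, List.drop_succ_cons]
          obtain ⟨c', hc'⟩ := drop_scan (v.take x) 0 y
          rw [zero_add] at hc'
          rw [hc', (incLen_scan _ 0 c').1 (Nat.zero_le _)]
          constructor
          · rintro (h | h)
            · exact h
            · omega
          · exact .inl
        · simp only [List.drop_append_of_le_length haj, incLen_zero_insert]
          constructor
          · rintro (h | ⟨-, -, m', rfl, h⟩) <;> omega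
          · intro h
            rcases le_max_iff.1 h with h | h
            · exact .inl h
            · rcases m with _ | m
              · exact .inl (Nat.zero_le _)
              · exact .inr ⟨by omega, by omega, m, rfl, by omega⟩
      · rw [List.take_append_of_le_length hcj, List.take_append_of_le_length hcj]
        constructor
        · rintro (h | h)
          · exact h
          · omega
        · exact .inl

theorem IsGrowth.forall_le_iff {n k : ℕ} {p : ℕ → ℕ} {T : ℕ → List ℕ} (hp : IsOpener n p)
    (h : IsGrowth n p T) {t : ℕ} (ht : t ≤ n) :
    (∀ x ∈ T t, x ≤ k) ↔ ¬ HasChain p t 0 t (k + 1) := by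
  rw [h.hasChain_iff hp t ht 0 t _ le_rfl, List.take_of_length_le (h.length t ht).le, List.drop_zero]
  constructor
  · intro hx
    have := incLen_le_sub hx 0
    omega
  · intro hx x hxm
    have := Ballot.le_incLen (b := 0) hxm (h.ballot t ht) fun r _ => rfl
    omega

/-! ### Blocks of partitions recovered from arcs -/

/-- The least element of the chain of arcs ending in `t`. -/
def root (p : ℕ → ℕ) (t : ℕ) : ℕ :=
  if _h : p t ≠ 0 ∧ p t < t then root p (p t) else t
termination_by t

theorem root_le (p : ℕ → ℕ) (t : ℕ) : root p t ≤ t := by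
  induction t using Nat.strong_induction_on with
  | _ t ih =>
    rw [root]
    split_ifs with h
    · exact (ih _ h.2).trans h.2.le
    · exact le_rfl

theorem IsOpener.root_eq {n : ℕ} {p : ℕ → ℕ} (hp : IsOpener n p) {t : ℕ} (h : p t ≠ 0) :
    root p (p t) = root p t := by
  conv_rhs => rw [root, dif_pos ⟨h, hp.lt t h⟩]

/-- If `p j < i`, the outer induction gives `p j ≤ p i`. Equality contradicts injectivity, and
strict inequality contradicts the inner induction at `p i`. -/
theorem IsOpener.le_of_root_eq {n : ℕ} {p : ℕ → ℕ} (hp : IsOpener n p) :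
    ∀ j i, root p i = root p j → i < j → p j ≠ 0 ∧ i ≤ p j := by
  intro j
  induction j using Nat.strong_induction_on with
  | _ j ih =>
    intro i
    induction i using Nat.strong_induction_on with
    | _ i ihi =>
      intro h hij
      have h0 : p j ≠ 0 := by
        intro h0
        rw [root.eq_1 p j, dif_neg (by simp [h0])] at h
        have := root_le p i
        omega
      refine ⟨h0, ?_⟩
      by_contra! hlt
      obtain ⟨h1, h2⟩ := ih i hij (p j) (by rw [hp.root_eq h0, h]) hlt
      rcases h2.eq_or_lt with h3 | h3
      · have := hp.inj j i h3 h0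
        omega
      · have h4 := hp.lt i h1
        have := (ihi (p i) h4 (by rw [hp.root_eq h1, h]) (h4.trans hij)).2
        omega

namespace CrossNest

/-- The opener of the arc with the closer `t`, or `0` if there is none. -/
noncomputable def opener {n : ℕ} (P : Finpartition (Finset.Icc 1 n)) (t : ℕ) : ℕ :=
  ((P.part t).filter (· < t)).sup id

theorem mem_standardRep_iff {n : ℕ} (P : Finpartition (Finset.Icc 1 n)) (i j : ℕ) :
    (i, j) ∈ standardRep P ↔ i ≠ 0 ∧ opener P j = i := by
  constructor
  · rintro ⟨B, hB, hi, hj, hij, hm⟩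
    dsimp only at hi hj hij hm
    have hBj : P.part j = B := P.part_eq_of_mem hB hj
    have h1 := Finset.mem_Icc.1 (P.le hB hi)
    refine ⟨by omega, le_antisymm (Finset.sup_le fun m hmem => ?_) ?_⟩
    · rw [hBj, Finset.mem_filter] at hmem
      by_contra hlt
      exact hm m hmem.1 ⟨not_le.1 hlt, hmem.2⟩
    · exact Finset.le_sup (f := id) (Finset.mem_filter.2 ⟨hBj.symm ▸ hi, hij⟩)
  · rintro ⟨h0, rfl⟩
    have hne : ((P.part j).filter (· < j)).Nonempty := by
      rw [Finset.nonempty_iff_ne_empty]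
      intro he
      exact h0 (by simp [opener, he])
    obtain ⟨x, hx, hxs⟩ := Finset.exists_mem_eq_sup _ hne id
    have hxe : opener P j = x := hxs
    rw [Finset.mem_filter] at hx
    have hj : j ∈ Finset.Icc 1 n := P.part_nonempty.1 ⟨x, hx.1⟩
    refine ⟨P.part j, P.part_mem.2 hj, ?_, P.mem_part hj, ?_, fun m hm hmj => ?_⟩
    · rw [hxe]; exact hx.1
    · rw [hxe]; exact hx.2
    · have : m ≤ opener P j := Finset.le_sup (f := id) (Finset.mem_filter.2 ⟨hm, hmj.2⟩)
      exact absurd hmj.1 (not_lt.2 this)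

theorem isOpener_opener {n : ℕ} (P : Finpartition (Finset.Icc 1 n)) : IsOpener n (opener P) := by
  have h : ∀ t, opener P t ≠ 0 → (opener P t, t) ∈ standardRep P := fun t ht =>
    (mem_standardRep_iff P _ _).2 ⟨ht, rfl⟩
  refine ⟨fun t ht => ?_, fun t ht => ?_, ?_⟩
  · obtain ⟨B, -, -, -, hlt, -⟩ := h t ht
    exact hlt
  · obtain ⟨B, hB, -, htB, -⟩ := h t ht
    exact (Finset.mem_Icc.1 (P.le hB htB)).2
  · intro s t hst hs
    obtain ⟨B, hB, h1, h2, h3, h4⟩ := h s hs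
    obtain ⟨C, hC, k1, k2, k3, k4⟩ := h t (hst ▸ hs)
    dsimp only at h1 h2 h3 h4 k1 k2 k3 k4
    rw [← hst] at k1 k3 k4
    obtain rfl := P.eq_of_mem_parts hB hC h1 k1
    rcases lt_trichotomy s t with hlt | he | hlt
    · exact (k4 s h2 ⟨h3, hlt⟩).elim
    · exact he
    · exact (h4 t k2 ⟨k3, hlt⟩).elim

theorem mem_part_comm {n : ℕ} (P : Finpartition (Finset.Icc 1 n)) {a b : ℕ} :
    a ∈ P.part b ↔ b ∈ P.part a := by
  simp only [Finpartition.mem_part_iff_exists, and_comm (a := a ∈ _)]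

/-- The elements of a block below `b` are `opener P b` and those below it, so descending along
openers rebuilds the block. -/
theorem opener_injective {n : ℕ} : Function.Injective (opener (n := n)) := by
  have key : ∀ P Q : Finpartition (Finset.Icc 1 n), opener P = opener Q →
      ∀ b, ∀ a ∈ P.part b, a < b → a ∈ Q.part b := by
    intro P Q h b
    induction b using Nat.strong_induction_on with
    | _ b ih =>
      intro a ha hab
      have hle : a ≤ opener P b := Finset.le_sup (f := id) (Finset.mem_filter.2 ⟨ha, hab⟩)
      have ha1 : a ∈ Finset.Icc 1 n := P.part_subset b ha
      have h0 : opener P b ≠ 0 := by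
        have := (Finset.mem_Icc.1 ha1).1
        omega
      obtain ⟨B, hB, h1, h2, h3, -⟩ := (mem_standardRep_iff P _ b).2 ⟨h0, rfl⟩
      obtain ⟨C, hC, k1, k2, -, -⟩ := (mem_standardRep_iff Q _ b).2 ⟨h0, (congrFun h b).symm⟩
      dsimp only at h1 h2 h3 k1 k2
      rw [Q.part_eq_of_mem hC k2]
      rcases hle.eq_or_lt with he | hlt
      · rwa [he]
      · have := ih _ h3 a (by
          rw [P.part_eq_of_mem hB h1, ← P.part_eq_of_mem hB h2]; exact ha) hlt
        rwa [Q.part_eq_of_mem hC k1] at this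
  have key2 : ∀ P Q : Finpartition (Finset.Icc 1 n), opener P = opener Q →
      ∀ b, P.part b ⊆ Q.part b := by
    intro P Q h b a ha
    rcases lt_trichotomy a b with hab | rfl | hab
    · exact key P Q h b a ha hab
    · exact Q.mem_part (P.part_subset a ha)
    · exact (mem_part_comm Q).1 (key P Q h a b ((mem_part_comm P).1 ha) hab)
  have key3 : ∀ P Q : Finpartition (Finset.Icc 1 n), opener P = opener Q →
      P.parts ⊆ Q.parts := by
    intro P Q h B hB
    obtain ⟨x, hx, rfl⟩ := P.part_surjOn hB
    rw [(key2 P Q h x).antisymm (key2 Q P h.symm x)]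
    exact Q.part_mem.2 hx
  intro P Q h
  exact Finpartition.ext ((key3 P Q h).antisymm (key3 Q P h.symm))

/-- The blocks are the fibres of `root p`. -/
theorem exists_opener_eq {n : ℕ} {p : ℕ → ℕ} (hp : IsOpener n p) :
    ∃ P : Finpartition (Finset.Icc 1 n), opener P = p := by
  classical
  let P := Finpartition.ofSetSetoid (Setoid.ker (root p)) (Finset.Icc 1 n)
  have hP : ∀ t x, x ∈ P.part t ↔ t ∈ Finset.Icc 1 n ∧ x ∈ Finset.Icc 1 n ∧ root p t = root p x :=
    fun t x => Finpartition.mem_part_ofSetSetoid_iff_rel _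
  refine ⟨P, funext fun t => le_antisymm (Finset.sup_le fun x hx => ?_) ?_⟩
  · rw [Finset.mem_filter, hP] at hx
    exact (hp.le_of_root_eq t x hx.1.2.2.symm hx.2).2
  · rcases Nat.eq_zero_or_pos (p t) with h0 | h0
    · rw [h0]; exact Nat.zero_le _
    · have h1 := hp.lt t h0.ne'
      have h2 := hp.le t h0.ne'
      refine Finset.le_sup (f := id) (Finset.mem_filter.2 ⟨(hP _ _).2 ⟨?_, ?_, ?_⟩, h1⟩)
      · exact Finset.mem_Icc.2 ⟨by omega, h2⟩
      · exact Finset.mem_Icc.2 ⟨h0, by omega⟩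
      · exact (hp.root_eq h0.ne').symm

theorem HasCrossing.mono {n m m' : ℕ} {P : Finpartition (Finset.Icc 1 n)} (h : HasCrossing P m)
    (hm : m' ≤ m) : HasCrossing P m' := by
  obtain ⟨i, j, h1, h2, h3, h4⟩ := h
  exact ⟨i ∘ Fin.castLE hm, j ∘ Fin.castLE hm, fun r => h1 _, h2.comp (Fin.strictMono_castLE hm),
    h3.comp (Fin.strictMono_castLE hm), fun r s => h4 _ _⟩

theorem isNoncrossing_iff {n k : ℕ} (P : Finpartition (Finset.Icc 1 n)) :
    IsNoncrossing k P ↔ ¬ HasCrossing P k := by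
  constructor
  · intro h hk
    exact absurd ((cr_isGreatest P).2 hk) (not_le.2 h)
  · intro h
    by_contra hk
    exact h ((cr_isGreatest P).1.mono (not_lt.1 hk))

theorem hasCrossing_succ_iff {n k : ℕ} (P : Finpartition (Finset.Icc 1 n)) :
    HasCrossing P (k + 1) ↔ ∃ t ≤ n, HasChain (opener P) t 0 t (k + 1) := by
  constructor
  · rintro ⟨i, j, h1, h2, h3, h4⟩
    simp only [mem_standardRep_iff] at h1
    -- The largest opener of the crossing separates its openers from its closers.
    refine ⟨i (Fin.last k), ?_, List.ofFn j, List.length_ofFn, List.pairwise_ofFn.2 fun r s hrs =>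
      ⟨h3 hrs, ?_⟩, fun x hx => ?_⟩
    · have := (isOpener_opener P).le (j (Fin.last k)) (by rw [(h1 _).2]; exact (h1 _).1)
      have := h4 (Fin.last k) (Fin.last k)
      omega
    · rw [(h1 r).2, (h1 s).2]; exact h2 hrs
    · obtain ⟨r, rfl⟩ := (List.mem_ofFn' _ _).1 hx
      refine ⟨h4 _ _, ?_⟩
      rw [(h1 r).2]
      exact ⟨Nat.pos_of_ne_zero (h1 r).1, h2.monotone (Fin.le_last r)⟩
  · rintro ⟨t, -, l, hl, hpw, hb⟩
    have hget : ∀ r : Fin (k + 1), l[(r : ℕ)]'(by omega) ∈ l := fun r => List.getElem_mem _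
    refine ⟨fun r => opener P (l[(r : ℕ)]'(by omega)), fun r => l[(r : ℕ)]'(by omega), fun r => ?_,
      fun r s hrs => ?_, fun r s hrs => ?_, fun r s => ?_⟩
    · exact (mem_standardRep_iff P _ _).2 ⟨(hb _ (hget r)).2.1.ne', rfl⟩
    · exact (List.pairwise_iff_getElem.1 hpw _ _ _ _ hrs).2
    · exact (List.pairwise_iff_getElem.1 hpw _ _ _ _ hrs).1
    · exact (hb _ (hget r)).2.2.trans_lt (hb _ (hget s)).1

theorem isNoncrossing_succ_iff {n d : ℕ} {P : Finpartition (Finset.Icc 1 n)} {T : ℕ → List ℕ}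
    (h : IsGrowth n (opener P) T) :
    IsNoncrossing (d + 1) P ↔ ∀ t ≤ n, ∀ x ∈ T t, x ≤ d := by
  rw [isNoncrossing_iff, hasCrossing_succ_iff]
  push Not
  exact forall₂_congr fun t ht => (h.forall_le_iff (isOpener_opener P) ht).symm

end CrossNest

/-! ### From tableaux to walks -/

/-- The numbers of the letters `1, …, d` in a word. -/
def rowLengths (d : ℕ) (L : List ℕ) : Fin d → ℤ := fun r => (L.count ((r : ℕ) + 1) : ℤ)

/-- The position after `s` steps of the walk given by the row lengths of the tableaux `T t` and
of the tableaux in between. -/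
def position (d : ℕ) (T : ℕ → List ℕ) (s : ℕ) : Fin d → ℤ :=
  if Even s then rowLengths d (T (s / 2)) else rowLengths d (T (s / 2 + 1)).dropLast

theorem position_even (d : ℕ) (T : ℕ → List ℕ) (t : ℕ) :
    position d T (2 * t) = rowLengths d (T t) := by
  simp [position]

theorem position_odd (d : ℕ) (T : ℕ → List ℕ) (t : ℕ) :
    position d T (2 * t + 1) = rowLengths d (T (t + 1)).dropLast := by
  have : (2 * t + 1) / 2 = t := by omega
  simp [position, this]

theorem Ballot.rowLengths_mem_chamber {L : List ℕ} (h : Ballot 0 L) (d : ℕ) :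
    rowLengths d L ∈ CrossNest.chamber d := by
  have hanti : Antitone fun r => L.count (r + 1) :=
    antitone_nat_of_succ_le fun r => by simpa using h.finish r
  exact ⟨fun i j hij => by
    simp only [rowLengths, Nat.cast_le]
    exact hanti (Fin.le_def.1 hij), fun i => by simp [rowLengths]⟩

theorem count_eq_zero_of_forall_le {d r : ℕ} {L : List ℕ} (hL : ∀ x ∈ L, x ≤ d) (hr : d < r) :
    L.count r = 0 :=
  List.count_eq_zero.2 fun h => (hL r h).not_gt hr

theorem count_succ_le_of_mem_chamber {d : ℕ} {L : List ℕ} (hL : ∀ x ∈ L, x ≤ d)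
    (h : rowLengths d L ∈ CrossNest.chamber d) (r : ℕ) :
    L.count (r + 1 + 1) ≤ L.count (r + 1) := by
  rcases Nat.lt_or_ge (r + 1) d with hr | hr
  · have := h.1 (show (⟨r, by omega⟩ : Fin d) ≤ ⟨r + 1, hr⟩ from Nat.le_succ r)
    simpa [rowLengths] using this
  · rw [count_eq_zero_of_forall_le hL (by omega)]
    exact Nat.zero_le _

theorem Ballot.concat {d a : ℕ} {U : List ℕ} (hU : Ballot 0 U) (hL : ∀ x ∈ U ++ [a], x ≤ d)
    (h : rowLengths d (U ++ [a]) ∈ CrossNest.chamber d) : Ballot 0 (U ++ [a]) := by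
  refine ballot_append.2 ⟨hU, fun r => hU.finish r, fun r => ?_⟩
  have := count_succ_le_of_mem_chamber hL h r
  simp only [List.count_append, List.count_singleton, beq_iff_eq, eq_comm (a := a)] at this
  simpa only [addBox, Pi.zero_apply, zero_add] using this

theorem rowLengths_concat_zero (d : ℕ) (U : List ℕ) :
    rowLengths d (U ++ [0]) = rowLengths d U := by
  funext r
  simp [rowLengths, List.count_append]

theorem rowLengths_concat_succ {d : ℕ} (U : List ℕ) (i : Fin d) :
    rowLengths d (U ++ [(i : ℕ) + 1]) = rowLengths d U + Pi.single i 1 := by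
  funext r
  simp only [rowLengths, List.count_append, List.count_singleton, beq_iff_eq, Pi.add_apply,
    Pi.single_apply, Nat.add_right_cancel_iff, Fin.ext_iff, eq_comm (a := (i : ℕ))]
  push_cast
  rfl

theorem rowLengths_eq_sub {d : ℕ} {T U : List ℕ} (i : Fin d)
    (h : ∀ r, T.count (r + 1) = U.count (r + 1) + if r = (i : ℕ) then 1 else 0) :
    rowLengths d U = rowLengths d T - Pi.single i 1 := by
  funext r
  simp only [rowLengths, h, Pi.sub_apply, Pi.single_apply, Fin.ext_iff]
  push_cast
  ring

theorem exists_eq_dropLast_concat {L : List ℕ} {t : ℕ} (h : L.length = t + 1) :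
    ∃ a, L = L.dropLast ++ [a] :=
  ⟨_, (List.dropLast_append_getLast (List.ne_nil_of_length_eq_add_one h)).symm⟩

theorem IsGrowth.isClosedWalk {n d : ℕ} {p : ℕ → ℕ} {T : ℕ → List ℕ} (h : IsGrowth n p T)
    (hT : ∀ t ≤ n, ∀ x ∈ T t, x ≤ d) :
    CrossNest.IsClosedWalk d n fun s => position d T s where
  start := by
    have h0 := List.eq_nil_of_length_eq_zero (h.length 0 (Nat.zero_le n))
    have := position_even d T 0
    rw [h0] at this
    funext r
    simpa [rowLengths] using congrFun this r
  finish := by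
    simp only [Fin.val_last, position_even, h.last]
    funext r
    simp [rowLengths, List.count_replicate]
  mem_chamber := by
    intro s
    have hs := s.2
    rcases Nat.even_or_odd' (s : ℕ) with ⟨t, ht | ht⟩
    · simp only [ht, position_even]
      exact (h.ballot t (by omega)).rowLengths_mem_chamber d
    · simp only [ht, position_odd]
      exact (h.ballot (t + 1) (by omega)).dropLast.rowLengths_mem_chamber d
  step_even := by
    intro s hs
    obtain ⟨t, ht⟩ := hs.exists_two_nsmul
    rw [smul_eq_mul] at ht
    have hlt := s.2
    simp only [Fin.val_succ, Fin.val_castSucc, ht, position_even, position_odd]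
    rcases h.closing t (by omega) with ⟨-, he⟩ | hi
    · rw [he]
      exact .inl rfl
    · obtain ⟨c, hc, -⟩ := hi.exists_row
      have hcd := lt_of_count_eq_add (hT t (by omega)) hc
      exact .inr ⟨⟨c, hcd⟩, rowLengths_eq_sub ⟨c, hcd⟩ hc⟩
  step_odd := by
    intro s hs
    obtain ⟨t, ht⟩ := hs
    have hlt := s.2
    simp only [Fin.val_succ, Fin.val_castSucc, ht]
    rw [show 2 * t + 1 + 1 = 2 * (t + 1) by ring, position_even, position_odd]
    obtain ⟨a, ha⟩ := exists_eq_dropLast_concat (h.length (t + 1) (by omega))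
    have had : a ≤ d := hT (t + 1) (by omega) a (by rw [ha]; simp)
    rcases a with _ | a
    · left
      conv_lhs => rw [ha]
      exact rowLengths_concat_zero _ _
    · right
      refine ⟨⟨a, had⟩, ?_⟩
      conv_lhs => rw [ha]
      exact rowLengths_concat_succ _ ⟨a, had⟩

/-! ### The walk determines the arcs -/

theorem count_eq_of_rowLengths_eq {d : ℕ} {L L' : List ℕ} (h : rowLengths d L = rowLengths d L') :
    ∀ r < d, L.count (r + 1) = L'.count (r + 1) := by
  intro r hr
  have := congrFun h ⟨r, hr⟩
  simpa [rowLengths] using this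

/-- Starting from the empty word, the odd positions fix the ejected labels and the even ones the
appended letters; letters being at most `d`, no box escapes the coordinates. -/
theorem IsGrowth.opener_eq_of_position_eq {n d : ℕ} {p p' : ℕ → ℕ} {T T' : ℕ → List ℕ}
    (hp : IsOpener n p) (hp' : IsOpener n p') (h : IsGrowth n p T) (h' : IsGrowth n p' T')
    (hT : ∀ t ≤ n, ∀ x ∈ T t, x ≤ d) (hT' : ∀ t ≤ n, ∀ x ∈ T' t, x ≤ d)
    (hw : ∀ s ≤ 2 * n, position d T s = position d T' s) : p = p' := by
  have key : ∀ t < n, T t = T' t →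
      p (t + 1) = p' (t + 1) ∧ (T (t + 1)).dropLast = (T' (t + 1)).dropLast := by
    intro t ht he
    have hw1 := hw (2 * t + 1) (by omega)
    rw [position_odd, position_odd] at hw1
    refine (h.closing t ht).unique ?_ (hT t ht.le) (count_eq_of_rowLengths_eq hw1)
    rw [he]
    exact h'.closing t ht
  have hTT : ∀ t ≤ n, T t = T' t := by
    intro t
    induction t with
    | zero =>
      intro _
      rw [List.eq_nil_of_length_eq_zero (h.length 0 (Nat.zero_le n)),
        List.eq_nil_of_length_eq_zero (h'.length 0 (Nat.zero_le n))]
    | succ t ih =>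
      intro ht
      obtain ⟨-, hU⟩ := key t ht (ih (by omega))
      obtain ⟨a, ha⟩ := exists_eq_dropLast_concat (h.length (t + 1) ht)
      obtain ⟨a', ha'⟩ := exists_eq_dropLast_concat (h'.length (t + 1) ht)
      have had : a ≤ d := hT (t + 1) ht a (by rw [ha]; simp)
      have had' : a' ≤ d := hT' (t + 1) ht a' (by rw [ha']; simp)
      have hw2 := hw (2 * (t + 1)) (by omega)
      rw [position_even, position_even, ha, ha', hU] at hw2
      have hc := count_eq_of_rowLengths_eq hw2
      simp only [List.count_append, List.count_singleton, beq_iff_eq] at hc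
      rw [ha, ha', hU]
      suffices a = a' by rw [this]
      rcases a with _ | a
      · rcases a' with _ | a'
        · rfl
        · have := hc a' had'
          simp at this
      · have := hc a had
        simp only [if_true] at this
        split_ifs at this
        · omega
        · omega
  funext s
  rcases s with _ | t
  · have h1 : p 0 = 0 := by_contra fun h0 => Nat.not_lt_zero _ (hp.lt 0 h0)
    have h2 : p' 0 = 0 := by_contra fun h0 => Nat.not_lt_zero _ (hp'.lt 0 h0)
    rw [h1, h2]
  · rcases Nat.lt_or_ge t n with ht | ht
    · exact (key t ht (hTT t ht.le)).1
    · have h1 : p (t + 1) = 0 := by_contra fun h0 => by have := hp.le _ h0; omega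
      have h2 : p' (t + 1) = 0 := by_contra fun h0 => by have := hp'.le _ h0; omega
      rw [h1, h2]

/-! ### From walks back to arcs -/

theorem IsGrowth.isOpener {n : ℕ} {p : ℕ → ℕ} {T : ℕ → List ℕ} (h : IsGrowth n p T)
    (h0 : p 0 = 0) (hn : ∀ t, n < t → p t = 0) : IsOpener n p := by
  have hle : ∀ t, p t ≠ 0 → ∃ s, t = s + 1 ∧ s < n := by
    intro t ht
    rcases t with _ | s
    · exact (ht h0).elim
    · exact ⟨s, rfl, by_contra fun hs => ht (hn _ (by omega))⟩
  have hdrop : ∀ t < n, ∀ x : ℕ, (T (t + 1)).dropLast[x]? = some 0 → (T (t + 1))[x]? = some 0 := by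
    intro t ht x hx
    rw [List.getElem?_dropLast] at hx
    split_ifs at hx
    exact hx
  have hstep : ∀ t < n, ∀ x : ℕ, (T t)[x]? = some 0 → (T (t + 1))[x]? = some 0 :=
    fun t ht x hx => hdrop t ht x (((h.closing t ht).getElem?_eq_zero x).1 hx).1
  -- An absent label never returns, while closing at a label requires it to be present; hence no
  -- opener is used twice.
  have hpersist : ∀ t t', t ≤ t' → t' ≤ n → ∀ x : ℕ, (T t)[x]? = some 0 → (T t')[x]? = some 0 := by
    intro t t' htt
    induction t', htt using Nat.le_induction with
    | base => exact fun _ _ hx => hx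
    | succ t' htt ih => exact fun ht' x hx => hstep t' ht' x (ih (by omega) x hx)
  have hlt : ∀ s t, s < t → p s = p t → p s ≠ 0 → False := by
    intro s t hst he hs
    obtain ⟨s, rfl, hsn⟩ := hle s hs
    obtain ⟨t, rfl, htn⟩ := hle t (he ▸ hs)
    obtain ⟨j, hj⟩ := Nat.exists_eq_succ_of_ne_zero hs
    have h1 : (T (s + 1))[j]? = some 0 := by
      rcases h.closing s hsn with ⟨h2, -⟩ | ⟨u, v, hU, -, hu⟩
      · exact (hs h2).elim
      · refine hdrop s hsn j ?_
        obtain rfl : j = u.length := by omega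
        rw [hU]
        simp
    have h2 := hpersist (s + 1) t (by omega) (by omega) j h1
    exact (((h.closing t htn).getElem?_eq_zero j).1 h2).2 (he ▸ hj)
  refine ⟨fun t ht => ?_, fun t ht => by_contra fun hlt => ht (hn t (by omega)), fun s t he hs => ?_⟩
  · obtain ⟨s, rfl, hsn⟩ := hle t ht
    have := (h.closing s hsn).le_length
    rw [h.length s hsn.le] at this
    omega
  · rcases lt_trichotomy s t with hst | hst | hst
    · exact (hlt s t hst he hs).elim
    · exact hst
    · exact (hlt t s hst he.symm (he ▸ hs)).elim

theorem CrossNest.IsClosedWalk.exists_isGrowth {n d : ℕ} {w : Fin (2 * n + 1) → Fin d → ℤ}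
    (hw : CrossNest.IsClosedWalk d n w) :
    ∃ p T, IsOpener n p ∧ IsGrowth n p T ∧ (∀ t ≤ n, ∀ x ∈ T t, x ≤ d) ∧
      (fun s : Fin (2 * n + 1) => position d T s) = w := by
  let Inv : ℕ → List ℕ → Prop := fun t L => L.length = t ∧ Ballot 0 L ∧ (∀ x ∈ L, x ≤ d) ∧
    ∀ s : Fin (2 * n + 1), (s : ℕ) = 2 * t → rowLengths d L = w s
  have step : ∀ t L, ∃ L' j, t < n → Inv t L → Inv (t + 1) L' ∧ IsClosing j L L'.dropLast ∧
      ∀ s : Fin (2 * n + 1), (s : ℕ) = 2 * t + 1 → rowLengths d L'.dropLast = w s := by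
    intro t L
    by_cases h : t < n ∧ Inv t L
    swap
    · exact ⟨[], 0, fun h1 h2 => (h ⟨h1, h2⟩).elim⟩
    obtain ⟨ht, hl, hb, hd, hL⟩ := h
    obtain ⟨j, U, hU, hbU, hwU⟩ : ∃ j U, IsClosing j L U ∧ Ballot 0 U ∧
        ∀ s : Fin (2 * n + 1), (s : ℕ) = 2 * t + 1 → rowLengths d U = w s := by
      have hs := hw.step_even ⟨2 * t, by omega⟩ (even_two_mul t)
      have hL' := hL (Fin.castSucc ⟨2 * t, by omega⟩) rfl
      rw [← hL'] at hs
      have huniq : ∀ s : Fin (2 * n + 1), (s : ℕ) = 2 * t + 1 →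
          s = Fin.succ ⟨2 * t, by omega⟩ := fun s hs => Fin.ext hs
      rcases hs with hs | ⟨i, hs⟩
      · exact ⟨0, L, .inl ⟨rfl, rfl⟩, hb, fun s hse => by rw [huniq s hse, hs]⟩
      · have hch := hw.mem_chamber (Fin.succ ⟨2 * t, by omega⟩)
        rw [hs] at hch
        have hlt : L.count ((i : ℕ) + 1 + 1) < L.count ((i : ℕ) + 1) := by
          rcases Nat.lt_or_ge ((i : ℕ) + 1) d with hi | hi
          · have := hch.1 (show i ≤ ⟨(i : ℕ) + 1, hi⟩ from Nat.le_succ _)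
            simp only [Pi.sub_apply, rowLengths, Pi.single_eq_same] at this
            rw [Pi.single_eq_of_ne (by simp [Fin.ext_iff])] at this
            omega
          · rw [count_eq_zero_of_forall_le hd (by omega)]
            have := hch.2 i
            simp only [Pi.sub_apply, rowLengths, Pi.single_eq_same] at this
            omega
        obtain ⟨j, U, hi, hbU, hc⟩ := hb.exists_isInsertion hlt
        exact ⟨j, U, .inr hi, hbU, fun s hse => by rw [huniq s hse, hs, rowLengths_eq_sub i hc]⟩
    have hdU := hU.forall_mem_le hd
    have hs := hw.step_odd ⟨2 * t + 1, by omega⟩ (odd_two_mul_add_one t)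
    rw [← hwU (Fin.castSucc ⟨2 * t + 1, by omega⟩) rfl] at hs
    have huniq : ∀ s : Fin (2 * n + 1), (s : ℕ) = 2 * (t + 1) →
        s = Fin.succ ⟨2 * t + 1, by omega⟩ := fun s hs =>
      Fin.ext (by simp only [Fin.val_succ]; omega)
    obtain ⟨a, had, ha⟩ : ∃ a ≤ d,
        rowLengths d (U ++ [a]) = w (Fin.succ ⟨2 * t + 1, by omega⟩) := by
      rcases hs with hs | ⟨i, hs⟩
      · exact ⟨0, Nat.zero_le d, by rw [hs, rowLengths_concat_zero]⟩
      · exact ⟨(i : ℕ) + 1, i.2, by rw [hs, rowLengths_concat_succ]⟩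
    have hda : ∀ x ∈ U ++ [a], x ≤ d := by
      intro x hx
      rcases List.mem_append.1 hx with hx | hx
      · exact hdU x hx
      · rw [List.mem_singleton.1 hx]; exact had
    refine ⟨U ++ [a], j, fun _ _ => ⟨⟨?_, hbU.concat hda (ha ▸ hw.mem_chamber _), hda,
      fun s hse => by rw [huniq s hse, ha]⟩, ?_, ?_⟩⟩
    · rw [List.length_append, ← hU.length_eq, hl, List.length_singleton]
    · rwa [List.dropLast_concat]
    · rwa [List.dropLast_concat]
  choose F G hFG using step
  let T : ℕ → List ℕ := fun t => Nat.rec [] F t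
  -- Outside `1, …, n` there are no closers, so the value is the default `0`.
  let p : ℕ → ℕ := fun s => if 0 < s ∧ s ≤ n then G (s - 1) (T (s - 1)) else 0
  have hInv : ∀ t ≤ n, Inv t (T t) := by
    intro t
    induction t with
    | zero =>
      intro _
      refine ⟨rfl, fun _ => le_rfl, by simp [T], fun s hs => ?_⟩
      rw [show s = 0 from Fin.ext (by simpa using hs), hw.start]
      funext r
      simp [rowLengths, T]
    | succ t ih => exact fun ht => (hFG t (T t) ht (ih (by omega))).1
  have hgrowth : IsGrowth n p T := by
    refine ⟨fun t ht => (hInv t ht).1, ?_, fun t ht => ?_⟩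
    · obtain ⟨h1, -, h3, h4⟩ := hInv n le_rfl
      -- The walk ends at the origin, so no letter from `1` to `d` is left, and larger letters are
      -- excluded.
      refine List.eq_replicate_iff.2 ⟨h1, fun x hx => ?_⟩
      have h5 := h4 (Fin.last (2 * n)) rfl
      rw [hw.finish] at h5
      rcases x with _ | x
      · rfl
      · have h6 := congrFun h5 ⟨x, h3 _ hx⟩
        have h7 := List.count_pos_iff.2 hx
        simp only [rowLengths, Pi.zero_apply] at h6
        omega
    · have := (hFG t (T t) ht (hInv t ht.le)).2.1
      have e : p (t + 1) = G t (T t) := if_pos ⟨Nat.succ_pos t, ht⟩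
      rw [e]
      exact this
  refine ⟨p, T, hgrowth.isOpener (by simp [p]) (fun t ht => if_neg (by omega)), hgrowth,
    fun t ht => (hInv t ht).2.2.1, funext fun s => ?_⟩
  have hs2 := s.2
  rcases Nat.even_or_odd' (s : ℕ) with ⟨t, ht | ht⟩
  · simp only [ht, position_even]
    exact (hInv t (by omega)).2.2.2 s ht
  · simp only [ht, position_odd]
    exact (hFG t (T t) (by omega) (hInv t (by omega))).2.2 s ht

theorem theorem3p3 (k n : ℕ) (hk : 1 ≤ k) :
    {P : Finpartition (Finset.Icc 1 n) | CrossNest.IsNoncrossing k P}.encard =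
      {w : Fin (2 * n + 1) → Fin (k - 1) → ℤ | CrossNest.IsClosedWalk (k - 1) n w}.encard := by
  obtain ⟨d, rfl⟩ : ∃ d, k = d + 1 := ⟨k - 1, by omega⟩
  rw [Nat.add_sub_cancel]
  choose T hT using fun P : Finpartition (Finset.Icc 1 n) =>
    (CrossNest.isOpener_opener P).exists_isGrowth
  have hbij : Set.BijOn (fun P (s : Fin (2 * n + 1)) => position d (T P) s)
      {P | CrossNest.IsNoncrossing (d + 1) P} {w | CrossNest.IsClosedWalk d n w} := by
    refine ⟨fun P hP => (hT P).isClosedWalk ((CrossNest.isNoncrossing_succ_iff (hT P)).1 hP),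
      fun P hP Q hQ h => ?_, fun w hw => ?_⟩
    · exact CrossNest.opener_injective ((hT P).opener_eq_of_position_eq
        (CrossNest.isOpener_opener P) (CrossNest.isOpener_opener Q) (hT Q)
        ((CrossNest.isNoncrossing_succ_iff (hT P)).1 hP)
        ((CrossNest.isNoncrossing_succ_iff (hT Q)).1 hQ)
        fun s hs => congrFun h ⟨s, by omega⟩)
    · obtain ⟨p, T', hp, hg, hd, rfl⟩ := CrossNest.IsClosedWalk.exists_isGrowth hw
      obtain ⟨P, rfl⟩ := CrossNest.exists_opener_eq hp
      -- The tableaux chosen for `P` may differ from `T'` only beyond `n`, where no position of the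
      -- walk looks.
      have hTT := (hT P).unique hg
      refine ⟨P, (CrossNest.isNoncrossing_succ_iff hg).2 hd, funext fun s => ?_⟩
      have hs := s.2
      rcases Nat.even_or_odd' (s : ℕ) with ⟨t, ht | ht⟩
      · simp only [ht, position_even, hTT t (by omega)]
      · simp only [ht, position_odd, hTT (t + 1) (by omega)]
  rw [← hbij.image_eq, hbij.injOn.encard_image]
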